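/- Let $q$ be a power of $2$ (with $q\ge 2$), let $\mathbb{F}_q$ be a field with $q$ elements, $A=\mathbb{F}_q[t]$, $K=\mathbb{F}_q(t)$, and let $K_\infty=\mathbb{F}_q((1/t))$ be the completion of $K$ at the infinite place. For $n\ge 1$ put $[n]=t^{q^n}-t$. For integers $k,d\ge 0$ let $S_d(k)=\sum_a a^{-k}\in K$, the sum being over the monic polynomials $a\in A$ of degree $d$, and let $S_{<d}(k)=\sum_{i=0}^{d-1}S_i(k)$. For integers $a\ge 1$, $b\ge 0$ let $$\zeta(a,b)=\sum_{d=0}^{\infty}S_d(a)\,S_{<d}(b)\in K_\infty ,$$ which for $b\ge 1$ is the multizeta value of depth two. Then the following identities hold. 1. Let $1\le s\le q$ and let $k_1\le\dots\le k_{s-1}$ be elements of $\{0,1\}$. For $b=sq^2-\sum_{i=1}^{s-1}q^{k_i}-1$ and $b'=sq^2-\sum_{i=1}^{s-1}q^{k_i}-q$, $$\zeta(2,b)=\frac{[1]^q}{[2]}\,\zeta(q+1,b').$$ 2. $$\zeta(2,\,2q^2-3q+1)=\frac{[1]^q}{[2]}\,\zeta(q+1,\,2q^2-4q+2).$$ 3.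 Let $s<q$ and let $k_i,l_i\in\{0,1\}$ ($1\le i\le s$) be such that $l_1\le\dots\le l_s$, $k_1\le\dots\le k_s$, $l_i\le k_i$ for all $i$, and $l_i<k_i$ for exactly one $i$. Then $$\zeta\Bigl(q^2-\sum_{i=1}^s q^{k_i},\,2q^2-3q+1\Bigr)=\frac{[1]^q}{[2]}\,\zeta\Bigl(q^2-\sum_{i=1}^s q^{l_i},\,2q^2-4q+2\Bigr).$$ 4. Let $0\le i\le 2$ and $0\le j\le 2-i$. For $b=q^3-iq^2-jq-(q-i-j)$ and $b'=q^3-iq^2-(q-(2-j))q-(2-i-j)$, $$\zeta(4q-2,\,b)=\frac{[1]^{(q-2)q}}{[2]^{q-2}}\,\zeta(q^2+q,\,b').$$ (For $q=2$, $i=2$, $j=0$ one has $b=b'=0$ and the identity is the trivial $\zeta(6,0)=\zeta(6,0)$; in all other cases all arguments are positive.) 5. If $q>2$ and $0\le i\le 2$, then $$\zeta\bigl(3q-1,\;q^3-(q-1)-q^i\bigr)=\frac{[1]^{(q-1)q}}{[2]^{q-1}}\,\zeta\bigl(q^2+q,\;q^3-(q-1)q-q^i\bigr).$$ -/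

import Mathlib

open Polynomial

/-- For a finite field `F`, the set of monic polynomials of degree `d` over `F` is finite. -/
theorem finite_monic_natDegree_eq (F : Type*) [Field F] [Fintype F] (d : ℕ) :
    {a : F[X] | a.Monic ∧ a.natDegree = d}.Finite := by
  have : Finite ↥{a : F[X] | a.Monic ∧ a.natDegree = d} :=
    Finite.of_equiv (Fin d → F)
      ((Polynomial.monicEquivDegreeLT d).trans (Polynomial.degreeLTEquiv F d).toEquiv).symm
  exact Set.toFinite _

/-- `A_{d+}`: the finite set of monic polynomials of degree `d` in `A = F[t]`. -/
noncomputable def monicsOfDegree (F : Type*) [Field F] [Fintype F] (d : ℕ) : Finset F[X] :=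
  (finite_monic_natDegree_eq F d).toFinset

/-- The element `[n] = t^(q^n) - t` of `F(t)`, where `q` is the cardinality of `F`. -/
noncomputable def carlitzBracket (F : Type*) [Field F] [Fintype F] (n : ℕ) : RatFunc F :=
  RatFunc.X ^ (Fintype.card F ^ n) - RatFunc.X

/-- The power sum `S_d(k)`: the sum of `1 / a^k` over the monic `a` of degree `d`. -/
noncomputable def powerSum (F : Type*) [Field F] [Fintype F] (d k : ℕ) : RatFunc F :=
  ∑ a ∈ monicsOfDegree F d, 1 / (algebraMap F[X] (RatFunc F) a) ^ k

/-- `S_{<d}(k) = S_0(k) + ... + S_{d-1}(k)`. -/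
noncomputable def powerSumLT (F : Type*) [Field F] [Fintype F] (d k : ℕ) : RatFunc F :=
  ∑ i ∈ Finset.range d, powerSum F i k

/-- The iterated power sum of depth two, `S_d(k₁, k₂) = S_d(k₁) S_{<d}(k₂)`. -/
noncomputable def iteratedPowerSum (F : Type*) [Field F] [Fintype F] (d k₁ k₂ : ℕ) : RatFunc F :=
  powerSum F d k₁ * powerSumLT F d k₂

/-- The multizeta value of depth two, `ζ(s₁, s₂) = ∑_{d ≥ 0} S_d(s₁, s₂)`, an element of the
completion `K_∞ = F((1/t))` of `F(t)` at the infinite place. -/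
noncomputable def multizeta (F : Type*) [Field F] [Fintype F] [DecidableEq (RatFunc F)]
    (s₁ s₂ : ℕ) : RatFunc.CompletionAtInfty F :=
  ∑' d : ℕ, algebraMap (RatFunc F) (RatFunc.CompletionAtInfty F) (iteratedPowerSum F d s₁ s₂)

theorem inftyValuation_powerSum_le (F : Type*) [Field F] [Fintype F] [DecidableEq (RatFunc F)]
    (d k : ℕ) : RatFunc.inftyValuation F (powerSum F d k) ≤ WithZero.exp (-((d * k : ℕ) : ℤ)) := by
  apply Valuation.map_sum_le
  intro a ha
  have ha' : a.Monic ∧ a.natDegree = d := by simpa [monicsOfDegree] using ha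
  have h1 : RatFunc.inftyValuation F (algebraMap F[X] (RatFunc F) a) = WithZero.exp (d : ℤ) := by
    rw [RatFunc.inftyValuation_apply, RatFunc.inftyValuation.polynomial F ha'.1.ne_zero, ha'.2]
  rw [map_div₀, map_pow, h1, map_one, one_div, ← WithZero.exp_nsmul, ← WithZero.exp_neg]
  apply le_of_eq
  congr 1
  simp [mul_comm]

theorem inftyValuation_iteratedPowerSum_le (F : Type*) [Field F] [Fintype F]
    [DecidableEq (RatFunc F)] (d k₁ k₂ : ℕ) (hk : 1 ≤ k₁) :
    RatFunc.inftyValuation F (iteratedPowerSum F d k₁ k₂) ≤ WithZero.exp (-(d : ℤ)) := by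
  have h1 : RatFunc.inftyValuation F (powerSum F d k₁) ≤ WithZero.exp (-(d : ℤ)) := by
    refine (inftyValuation_powerSum_le F d k₁).trans (WithZero.exp_le_exp.2 ?_)
    have : d ≤ d * k₁ := Nat.le_mul_of_pos_right d hk
    omega
  have h2 : RatFunc.inftyValuation F (powerSumLT F d k₂) ≤ 1 := by
    apply Valuation.map_sum_le
    intro i _
    refine (inftyValuation_powerSum_le F i k₂).trans ?_
    rw [← WithZero.exp_zero]
    exact WithZero.exp_le_exp.2 (by omega)
  rw [iteratedPowerSum, map_mul]
  calc _ ≤ WithZero.exp (-(d : ℤ)) * 1 := mul_le_mul' h1 h2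
    _ = _ := mul_one _

/-- The additive group of a valued ring is nonarchimedean. -/
theorem nonarchimedeanAddGroup_of_valued (R : Type*) [Ring R] (Γ : Type*)
    [LinearOrderedCommGroupWithZero Γ] [Valued R Γ] : NonarchimedeanAddGroup R := by
  constructor
  intro U hU
  obtain ⟨γ, hγ⟩ := Valued.mem_nhds_zero.1 hU
  have hmem : ((Valued.v.restrict (R := R)).ltAddSubgroup γ : Set R) ∈ nhds (0 : R) :=
    Valued.mem_nhds_zero.2 ⟨γ, fun x hx => hx⟩
  exact ⟨⟨_, AddSubgroup.isOpen_of_mem_nhds _ hmem⟩, fun x hx => hγ hx⟩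

/-- The series defining a multizeta value converges. -/
theorem summable_multizeta (F : Type*) [Field F] [Fintype F] [DecidableEq (RatFunc F)]
    (s₁ s₂ : ℕ) (hs : 1 ≤ s₁) :
    Summable fun d : ℕ =>
      algebraMap (RatFunc F) (RatFunc.CompletionAtInfty F) (iteratedPowerSum F d s₁ s₂) := by
  have : CompleteSpace (RatFunc.CompletionAtInfty F) := by
    let := (RatFunc.inftyValued F)
    exact inferInstanceAs (CompleteSpace (UniformSpace.Completion (RatFunc F)))
  have hv : ∀ x : RatFunc F, Valued.v (algebraMap (RatFunc F) (RatFunc.CompletionAtInfty F) x)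
      = RatFunc.inftyValuation F x := by
    intro x
    let := (RatFunc.inftyValued F)
    exact Valued.valuedCompletion_apply x
  have := nonarchimedeanAddGroup_of_valued (RatFunc.CompletionAtInfty F) _
  apply NonarchimedeanAddGroup.summable_of_tendsto_cofinite_zero
  rw [Nat.cofinite_eq_atTop, Filter.tendsto_def]
  intro U hU
  obtain ⟨γ, hγ⟩ := Valued.mem_nhds_zero.1 hU
  have hne : MonoidWithZeroHom.ValueGroup₀.embedding γ.1 ≠ 0 := by
    simp
  obtain ⟨n, hn⟩ : ∃ n : ℤ, MonoidWithZeroHom.ValueGroup₀.embedding γ.1 = WithZero.exp n :=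
    ⟨_, (WithZero.exp_log hne).symm⟩
  refine Filter.mem_of_superset (Filter.Ioi_mem_atTop (-n).toNat) fun d hd => hγ ?_
  have hd' : (-n).toNat < d := hd
  change Valued.v.restrict _ < γ.1
  rw [Valuation.restrict_lt_iff_lt_embedding, hn, hv]
  refine (inftyValuation_iteratedPowerSum_le F d s₁ s₂ hs).trans_lt (WithZero.exp_lt_exp.2 ?_)
  omega

/-! The identities hold term by term in d, because every power sum involved has a closed form. Write
c for `carlitzCoeff F d`, and u, v for `bracketRatio F 1 d`, `bracketRatio F 2 d`. Logarithmic
derivatives of products of 1 - x/a and of 1 - (x/a)^(q-1) give, in characteristic two, ∑ S_d(k) x^k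
= c x / (1 - E_d(x)) and, over multiples of q - 1, 1 + ∑ S_{<d}(k) x^k = c x / E_d(x), with E_d the
Carlitz polynomial. Modulo x^(q^3), E_d = c x + u c^q x^q + u^q v c^(q^2) x^(q^2), so the
coefficients satisfy short recurrences, solved by truncated binomial expansions
(`powerSum_eq_truncBinom`, `powerSumLT_eq_truncBinom`).

Where the truncation drops nothing, these become S_d(k) = c^k (1+u)^i and S_{<d}(k) = c^k u^(sq)
(u+v)^n (`powerSum_eq`, `powerSumLT_eq`); in a few other cases the parity of a binomial coefficient
gives an equally simple form. The crux is `bracketRatio_add_bracketRatio`: u + v = ρ (1+u) with ρ =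
[1]^q/[2]. A factor of S_{<d} can thus be traded for a factor 1+u of S_d at the price of ρ. Both
sides of each identity have the same weight, so the powers of c agree, and 1, q-2 or q-1 factors are
traded (`multizeta_eq_mul_of_termwise`). -/

/-! ### Truncated binomial expansions and the recurrences they solve. -/

section TruncatedBinomial

variable {R : Type*} [CommRing R]

/-- The truncated binomial expansion `∑_{j ≤ s} (n choose j) z^(n-j) g^j`. -/
def truncBinom (z g : R) (s n : ℕ) : R :=
  ∑ j ∈ Finset.range (s + 1), (n.choose j : R) * z ^ (n - j) * g ^ j

theorem truncBinom_zero_left (z g : R) (n : ℕ) : truncBinom z g 0 n = z ^ n := by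
  simp [truncBinom]

theorem truncBinom_zero_right (z g : R) (s : ℕ) : truncBinom z g s 0 = 1 := by
  simp [truncBinom, Finset.sum_range_succ']

/-- Pascal's rule survives truncation; it is what matches these expansions to the linear recurrences
below. -/
theorem truncBinom_succ_succ (z g : R) (s n : ℕ) :
    truncBinom z g (s + 1) (n + 1) = z * truncBinom z g (s + 1) n + g * truncBinom z g s n := by
  have key : ∀ j, ((n.choose (j + 1) : ℕ) : R) * z ^ (n - j)
      = z * ((n.choose (j + 1) : ℕ) * z ^ (n - (j + 1))) := by
    intro j
    rcases lt_or_ge j n with h | h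
    · rw [show n - j = (n - (j + 1)) + 1 by omega]; ring
    · rw [Nat.choose_eq_zero_of_lt (by omega)]; simp
  unfold truncBinom
  rw [Finset.sum_range_succ', Finset.sum_range_succ' _ (s + 1), mul_add, Finset.mul_sum,
    Finset.mul_sum, add_right_comm, ← Finset.sum_add_distrib]
  congr 1
  · refine Finset.sum_congr rfl fun j _ => ?_
    rw [Nat.choose_succ_succ, Nat.cast_add, Nat.add_sub_add_right]
    linear_combination g ^ (j + 1) * key j
  · simp [pow_succ']

theorem truncBinom_eq_add_pow (z g : R) {s n : ℕ} (h : n ≤ s) :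
    truncBinom z g s n = (z + g) ^ n := by
  rw [add_comm z g, add_pow, truncBinom]
  symm
  refine Finset.sum_subset_zero_on_sdiff (Finset.range_mono (by omega)) ?_ ?_
  · intro j hj
    have : n < j := by simp at hj; omega
    simp [Nat.choose_eq_zero_of_lt this]
  · intro j _; ring

theorem truncBinom_one_left (z g : R) (n : ℕ) :
    truncBinom z g 1 (n + 1) = z ^ n * (z + (n + 1 : ℕ) * g) := by
  simp [truncBinom, Finset.sum_range_succ]; ring

/-- The inner binomial coefficients of a power of two are even, and the truncation omits the last
one. This glues the end of one block of q indices to the start of the next. -/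
theorem truncBinom_two_pow [CharP R 2] (z g : R) {s m : ℕ} (h : s < 2 ^ m) :
    truncBinom z g s (2 ^ m) = z ^ 2 ^ m := by
  rw [truncBinom, Finset.sum_range_succ', Finset.sum_eq_zero]
  · simp
  intro j hj
  rw [(CharP.cast_eq_zero_iff R 2 _).2
    (Nat.prime_two.dvd_choose_pow (by omega) (by simp at hj; omega))]
  simp

/-- The coefficients of `1 / (1 + z w + z^q g w^(q+1))` in characteristic two. -/
theorem eq_truncBinom_of_recurrence [CharP R 2] {q m : ℕ} (hq : q = 2 ^ m) (z g : R) (B : ℕ → R)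
    (h0 : B 0 = 1) (h1 : ∀ k < q, B (k + 1) = z * B k)
    (h2 : ∀ k, k + q < q ^ 2 + q → B (k + q + 1) = z * B (k + q) + z ^ q * g * B k) :
    ∀ s ≤ q, ∀ n ≤ q, B (s * q + n) = z ^ (s * q) * truncBinom z g s n := by
  intro s
  induction s with
  | zero =>
    intro _ n hn
    induction n with
    | zero => simp [h0, truncBinom_zero_right]
    | succ n ih =>
      have := ih (by omega)
      simp only [zero_mul, zero_add, pow_zero, one_mul, truncBinom_zero_left] at this ⊢
      rw [h1 n (by omega), this, pow_succ']
  | succ s ihs =>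
    intro hs n hn
    induction n with
    | zero =>
      -- The index (s+1)q + 0 is also s q + q, the last index of the previous block.
      have := ihs (by omega) q le_rfl
      rw [add_zero, add_mul, one_mul, this, truncBinom_zero_right]
      subst hq
      rw [truncBinom_two_pow _ _ (by omega), pow_add, mul_one]
    | succ n ih =>
      have e1 := ih (by omega)
      have e2 := ihs (by omega) n (by omega)
      have hlt : (s + 1) * q + n < q ^ 2 + q := by nlinarith
      have := h2 (s * q + n) (by nlinarith)
      rw [show s * q + n + q = (s + 1) * q + n by ring, e1, e2] at this
      rw [← add_assoc, this, truncBinom_succ_succ]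
      ring

/-- The coefficients of `c / (1 + c y + a c^q y^q)` in characteristic two. -/
theorem eq_truncBinom_of_recurrence' [CharP R 2] {q m : ℕ} (hq : q = 2 ^ m) (c a : R) (A : ℕ → R)
    (h0 : A 0 = c) (h1 : ∀ k, k + 1 < q → A (k + 1) = c * A k)
    (h2 : ∀ k, k + q < q ^ 2 → A (k + q) = c * A (k + q - 1) + a * c ^ q * A k) :
    ∀ e < q, ∀ f < q, A (e * q + f) = c ^ (e * q + f + 1) * truncBinom 1 a e (q - 1 - f) := by
  intro e
  induction e with
  | zero =>
    intro _ f hf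
    induction f with
    | zero => simp [h0, truncBinom_zero_left]
    | succ f ih =>
      have := ih (by omega)
      simp only [zero_mul, zero_add, one_pow, mul_one, truncBinom_zero_left] at this ⊢
      rw [h1 f (by omega), this, pow_succ' _ (f + 1)]
  | succ e ihe =>
    intro he f hf
    have hb : (e + 1) * q + f < q ^ 2 := by nlinarith
    induction f with
    | zero =>
      have e1 := ihe (by omega) (q - 1) (by omega)
      have e2 := ihe (by omega) 0 (by omega)
      -- At a block boundary Pascal's rule is applied to the exponent q, whose truncated expansion
      -- is 1.
      have e3 : truncBinom 1 a (e + 1) (q - 1 + 1) = 1 := by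
        rw [show q - 1 + 1 = q by omega]
        subst hq
        rw [truncBinom_two_pow _ _ he, one_pow]
      rw [truncBinom_succ_succ, one_mul, add_comm, ← CharTwo.sub_eq_add, sub_eq_iff_eq_add] at e3
      have := h2 (e * q) (by nlinarith)
      rw [show e * q + q - 1 = e * q + (q - 1) by omega, e1, ← add_zero (e * q), e2,
        show q - 1 - (q - 1) = 0 by omega, truncBinom_zero_right] at this
      rw [show (e + 1) * q + 0 = e * q + 0 + q by ring, this, Nat.sub_zero,
        show e * q + 0 + (q - 1) + 1 = e * q + q by omega]
      have e4 : truncBinom 1 a (e + 1) (q - 1) = 1 + a * truncBinom 1 a e (q - 1) := by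
        linear_combination -e3 - CharTwo.add_self_eq_zero (1 : R)
      rw [e4]; ring
    | succ f ih =>
      have e1 := ih (by omega) (by omega)
      have e2 := ihe (by omega) (f + 1) hf
      have e3 := truncBinom_succ_succ 1 a e (q - 1 - (f + 1))
      rw [show q - 1 - (f + 1) + 1 = q - 1 - f by omega] at e3
      have := h2 (e * q + (f + 1)) (by nlinarith)
      rw [show e * q + (f + 1) + q - 1 = (e + 1) * q + f by rw [add_mul]; omega, e1, e2, e3] at this
      rw [show (e + 1) * q + (f + 1) = e * q + (f + 1) + q by ring, this]
      linear_combination c ^ (e * q + f + 1 + q + 1) * a *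
        CharTwo.add_self_eq_zero (truncBinom 1 a e (q - 1 - (f + 1)))

end TruncatedBinomial

/-! ### Carlitz polynomials and their factorizations over monic polynomials. -/

section CarlitzPolynomials

variable (F : Type*) [Field F] [Fintype F]

theorem mem_monicsOfDegree {d : ℕ} {a : F[X]} :
    a ∈ monicsOfDegree F d ↔ a.Monic ∧ a.natDegree = d := by
  simp [monicsOfDegree]

theorem card_monicsOfDegree (d : ℕ) : (monicsOfDegree F d).card = Fintype.card F ^ d := by
  rw [monicsOfDegree, ← Nat.card_eq_card_finite_toFinset]
  exact (Nat.card_congr ((Polynomial.monicEquivDegreeLT (R := F) d).trans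
    (Polynomial.degreeLTEquiv F d).toEquiv)).trans (by simp)

theorem carlitzBracket_eq_algebraMap (n : ℕ) :
    carlitzBracket F n = algebraMap F[X] (RatFunc F) (X ^ (Fintype.card F ^ n) - X) := by
  simp [carlitzBracket]

theorem carlitzBracket_ne_zero {n : ℕ} (hn : n ≠ 0) : carlitzBracket F n ≠ 0 := by
  rw [carlitzBracket_eq_algebraMap, Ne, FaithfulSMul.algebraMap_eq_zero_iff]
  exact FiniteField.X_pow_card_sub_X_ne_zero F (Nat.one_lt_pow hn Fintype.one_lt_card)

/-- The `q`-power map is additive on commutative `F`-algebras. -/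
theorem add_pow_fintype_card {R : Type*} [CommRing R] [Algebra F R] (x y : R) :
    (x + y) ^ Fintype.card F = x ^ Fintype.card F + y ^ Fintype.card F := by
  cases subsingleton_or_nontrivial R
  · exact Subsingleton.elim _ _
  obtain ⟨p, hp⟩ := CharP.exists F
  obtain ⟨n, hpr, hn⟩ := FiniteField.card F p
  have := Fact.mk hpr
  have := charP_of_injective_algebraMap (algebraMap F R).injective p
  rw [hn, add_pow_char_pow]

theorem sub_pow_fintype_card {R : Type*} [CommRing R] [Algebra F R] (x y : R) :
    (x - y) ^ Fintype.card F = x ^ Fintype.card F - y ^ Fintype.card F := by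
  rw [eq_sub_iff_add_eq, ← add_pow_fintype_card, sub_add_cancel]

theorem carlitzBracket_pow_card (n : ℕ) :
    carlitzBracket F n ^ Fintype.card F = carlitzBracket F (n + 1) - carlitzBracket F 1 := by
  rw [carlitzBracket, sub_pow_fintype_card, ← pow_mul, ← pow_succ, carlitzBracket, carlitzBracket,
    pow_one]
  ring

/-- The Carlitz polynomials `E_d = e_d / D_d`: the `F`-linear polynomials that vanish on the
polynomials of degree less than `d` and take the value one at the monic ones of degree `d`. -/
noncomputable def carlitzPoly : ℕ → (RatFunc F)[X]
  | 0 => X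
  | d + 1 => C (carlitzBracket F (d + 1))⁻¹ * (carlitzPoly d ^ Fintype.card F - carlitzPoly d)

theorem C_carlitzBracket_mul_carlitzPoly_succ (d : ℕ) :
    C (carlitzBracket F (d + 1)) * carlitzPoly F (d + 1)
      = carlitzPoly F d ^ Fintype.card F - carlitzPoly F d := by
  rw [carlitzPoly, ← mul_assoc, ← C_mul, mul_inv_cancel₀ (carlitzBracket_ne_zero F d.succ_ne_zero),
    C_1, one_mul]

theorem carlitzBracket_mul_eval_carlitzPoly_succ (d : ℕ) (x : RatFunc F) :
    carlitzBracket F (d + 1) * (carlitzPoly F (d + 1)).eval x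
      = (carlitzPoly F d).eval x ^ Fintype.card F - (carlitzPoly F d).eval x := by
  simpa using congrArg (eval x) (C_carlitzBracket_mul_carlitzPoly_succ F d)

theorem natDegree_carlitzPoly_le (d : ℕ) : (carlitzPoly F d).natDegree ≤ Fintype.card F ^ d := by
  induction d with
  | zero => simp [carlitzPoly]
  | succ d ih =>
    refine (natDegree_C_mul_le _ _).trans ((natDegree_sub_le _ _).trans (max_le ?_ ?_))
    · refine natDegree_pow_le.trans ?_
      rw [pow_succ']
      exact Nat.mul_le_mul_left _ ih
    · exact ih.trans (Nat.pow_le_pow_right Fintype.card_pos d.le_succ)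

theorem eval_carlitzPoly_add (d : ℕ) (x y : RatFunc F) :
    (carlitzPoly F d).eval (x + y) = (carlitzPoly F d).eval x + (carlitzPoly F d).eval y := by
  induction d with
  | zero => simp [carlitzPoly]
  | succ d ih => simp [carlitzPoly, ih, add_pow_fintype_card]; ring

theorem C_algebraMap_pow_card (θ : F) :
    (C (algebraMap F (RatFunc F) θ)) ^ Fintype.card F = C (algebraMap F (RatFunc F) θ) := by
  rw [← C_pow, ← map_pow, FiniteField.pow_card]

theorem carlitzPoly_comp_C_mul_X (d : ℕ) (θ : F) :
    (carlitzPoly F d).comp (C (algebraMap F (RatFunc F) θ) * X)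
      = C (algebraMap F (RatFunc F) θ) * carlitzPoly F d := by
  induction d with
  | zero => simp [carlitzPoly]
  | succ d ih =>
    rw [carlitzPoly, mul_comp, sub_comp, pow_comp, ih, C_comp, mul_pow, C_algebraMap_pow_card]
    ring

theorem eval_carlitzPoly_algebraMap_mul (d : ℕ) (θ : F) (x : RatFunc F) :
    (carlitzPoly F d).eval (algebraMap F (RatFunc F) θ * x)
      = algebraMap F (RatFunc F) θ * (carlitzPoly F d).eval x := by
  simpa using congrArg (eval x) (carlitzPoly_comp_C_mul_X F d θ)

theorem eval_carlitzPoly_zero (d : ℕ) : (carlitzPoly F d).eval 0 = 0 := by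
  simpa using eval_carlitzPoly_algebraMap_mul F d 0 0

/-- Multiplication by t mixes consecutive Carlitz polynomials. The induction raises the defining
recursion to the q-th power and uses [n]^q = [n+1] - [1]. -/
theorem eval_carlitzPoly_X_mul (d : ℕ) (x : RatFunc F) :
    (carlitzPoly F (d + 1)).eval (RatFunc.X * x)
      = RatFunc.X * (carlitzPoly F (d + 1)).eval x
        + (carlitzPoly F d).eval x ^ Fintype.card F := by
  apply mul_left_cancel₀ (carlitzBracket_ne_zero F d.succ_ne_zero)
  induction d with
  | zero =>
    rw [mul_add, mul_left_comm, carlitzBracket_mul_eval_carlitzPoly_succ,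
      carlitzBracket_mul_eval_carlitzPoly_succ]
    simp [carlitzPoly, carlitzBracket]
    ring
  | succ d ih =>
    have ih' := mul_left_cancel₀ (carlitzBracket_ne_zero F d.succ_ne_zero) ih
    rw [mul_add, mul_left_comm, carlitzBracket_mul_eval_carlitzPoly_succ,
      carlitzBracket_mul_eval_carlitzPoly_succ, ih', add_pow_fintype_card, mul_pow]
    have h1 := congrArg (· ^ Fintype.card F) (carlitzBracket_mul_eval_carlitzPoly_succ F d x)
    simp only [mul_pow, sub_pow_fintype_card, carlitzBracket_pow_card] at h1
    have h2 : RatFunc.X ^ Fintype.card F = carlitzBracket F 1 + (RatFunc.X : RatFunc F) := by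
      simp [carlitzBracket]
    rw [h2]
    linear_combination -h1

theorem eval_carlitzPoly_X_pow (d : ℕ) : (carlitzPoly F d).eval (RatFunc.X ^ d) = 1 := by
  induction d with
  | zero => simp [carlitzPoly]
  | succ d ih =>
    have h : (carlitzPoly F (d + 1)).eval (RatFunc.X ^ d) = 0 := by
      apply mul_left_cancel₀ (carlitzBracket_ne_zero F d.succ_ne_zero)
      rw [carlitzBracket_mul_eval_carlitzPoly_succ, ih]
      simp
    rw [pow_succ', eval_carlitzPoly_X_mul, h, ih]
    simp

/-- On degree at most d the values of E_d lie in F, hence are fixed by the q-power map, so E_{d+1}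
vanishes there; by linearity only the leading term contributes to the next value. -/
theorem eval_carlitzPoly_of_natDegree_le (d : ℕ) {b : F[X]} (hb : b.natDegree ≤ d) :
    (carlitzPoly F d).eval (algebraMap F[X] (RatFunc F) b)
      = algebraMap F (RatFunc F) (b.coeff d) := by
  induction d generalizing b with
  | zero =>
    rw [eq_C_of_natDegree_le_zero hb, carlitzPoly, eval_X, coeff_C_zero,
      IsScalarTower.algebraMap_apply F F[X] (RatFunc F)]
    rfl
  | succ d ih =>
    have h0 : ∀ c : F[X], c.natDegree ≤ d →
        (carlitzPoly F (d + 1)).eval (algebraMap F[X] (RatFunc F) c) = 0 := by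
      intro c hc
      apply mul_left_cancel₀ (carlitzBracket_ne_zero F d.succ_ne_zero)
      rw [carlitzBracket_mul_eval_carlitzPoly_succ, ih hc, ← map_pow, FiniteField.pow_card]
      simp
    have h1 : b = b.erase (d + 1) + C (b.coeff (d + 1)) * X ^ (d + 1) := by
      rw [C_mul_X_pow_eq_monomial, add_comm, monomial_add_erase]
    have h2 : (b.erase (d + 1)).natDegree ≤ d := by
      rw [natDegree_le_iff_coeff_eq_zero]
      intro N hN
      rw [coeff_erase]
      split_ifs with h
      · rfl
      · exact coeff_eq_zero_of_natDegree_lt (by omega)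
    have h3 : algebraMap F[X] (RatFunc F) (C (b.coeff (d + 1)) * X ^ (d + 1))
        = algebraMap F (RatFunc F) (b.coeff (d + 1)) * RatFunc.X ^ (d + 1) := by
      rw [map_mul, map_pow, RatFunc.algebraMap_X, IsScalarTower.algebraMap_apply F F[X] (RatFunc F)]
      rfl
    conv_lhs => rw [h1, map_add, eval_carlitzPoly_add, h0 _ h2, h3, eval_carlitzPoly_algebraMap_mul,
      eval_carlitzPoly_X_pow]
    simp

/-- Both sides have degree at most q^d and agree at q^d + 1 points: at 0, and at the monic
polynomials of degree d, where both vanish. -/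
theorem prod_one_sub_eq_one_sub_carlitzPoly (d : ℕ) :
    ∏ a ∈ monicsOfDegree F d, (1 - C (algebraMap F[X] (RatFunc F) a)⁻¹ * X)
      = 1 - carlitzPoly F d := by
  classical
  have hinj := FaithfulSMul.algebraMap_injective F[X] (RatFunc F)
  have h0 : (0 : RatFunc F) ∉ (monicsOfDegree F d).image (algebraMap F[X] (RatFunc F)) := by
    simp only [Finset.mem_image, not_exists, not_and, mem_monicsOfDegree]
    rintro a ⟨ha, -⟩ h
    exact ha.ne_zero (by simpa using h)
  refine eq_of_natDegree_lt_card_of_eval_eq' _ _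
    (insert 0 ((monicsOfDegree F d).image (algebraMap F[X] (RatFunc F)))) ?_ ?_
  · intro x hx
    rw [Finset.mem_insert, Finset.mem_image] at hx
    rcases hx with rfl | ⟨a, ha, rfl⟩
    · simp [eval_prod, eval_carlitzPoly_zero]
    · have ha' := (mem_monicsOfDegree F).1 ha
      have hne : algebraMap F[X] (RatFunc F) a ≠ 0 := by simpa using ha'.1.ne_zero
      rw [eval_prod, Finset.prod_eq_zero ha (by simp [hne]), eval_sub, eval_one,
        eval_carlitzPoly_of_natDegree_le F d ha'.2.le, ← ha'.2, ha'.1.coeff_natDegree]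
      simp
  · rw [Finset.card_insert_of_notMem h0, Finset.card_image_of_injective _ hinj,
      card_monicsOfDegree, Nat.lt_succ_iff]
    refine max_le ?_ ?_
    · refine (natDegree_prod_le _ _).trans ?_
      refine (Finset.sum_le_card_nsmul _ _ 1 fun a _ => ?_).trans ?_
      · refine (natDegree_sub_le _ _).trans (max_le (by simp) ?_)
        exact (natDegree_C_mul_le _ _).trans natDegree_X_le
      · simp [card_monicsOfDegree]
    · refine (natDegree_sub_le _ _).trans (max_le (by simp) (natDegree_carlitzPoly_le F d))

theorem prod_units_one_sub [DecidableEq F] {R : Type*} [CommRing R] [Algebra F R] (z : R) :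
    ∏ θ : Fˣ, (1 - algebraMap F R θ * z) = 1 - z ^ (Fintype.card F - 1) := by
  have h : ∏ θ : Fˣ, (1 - C (θ : F) * X) = 1 - (X : F[X]) ^ (Fintype.card F - 1) := by
    refine eq_of_natDegree_lt_card_of_eval_eq' _ _ Finset.univ ?_ ?_
    · intro x _
      rcases eq_or_ne x 0 with rfl | hx
      · have : Fintype.card F - 1 ≠ 0 := by have := Fintype.one_lt_card (α := F); omega
        simp [eval_prod, this]
      · rw [eval_prod, Finset.prod_eq_zero (Finset.mem_univ (Units.mk0 x hx)⁻¹) (by simp [hx])]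
        simp [FiniteField.pow_card_sub_one_eq_one x hx]
    · have hpos := Fintype.card_pos (α := F)
      rw [Finset.card_univ]
      suffices h : _ ≤ Fintype.card F - 1 from Nat.lt_of_le_sub_one hpos h
      refine max_le ?_ ?_
      · refine (natDegree_prod_le _ _).trans ?_
        refine (Finset.sum_le_card_nsmul _ _ 1 fun a _ => ?_).trans ?_
        · refine (natDegree_sub_le _ _).trans (max_le (by simp) ?_)
          exact (natDegree_C_mul_le _ _).trans natDegree_X_le
        · simp [Fintype.card_units]
      · exact (natDegree_sub_le _ _).trans (max_le (by simp) (by simp))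
  simpa [map_prod] using congrArg (aeval z) h

/-- Substitute θX for X in the previous factorization and multiply over θ in Fˣ, using the
F-linearity of E_d. -/
theorem prod_one_sub_pow_eq_one_sub_carlitzPoly_pow (d : ℕ) :
    ∏ a ∈ monicsOfDegree F d,
        (1 - (C (algebraMap F[X] (RatFunc F) a)⁻¹ * X) ^ (Fintype.card F - 1))
      = 1 - carlitzPoly F d ^ (Fintype.card F - 1) := by
  classical
  have halg : ∀ θ : F, algebraMap F (RatFunc F)[X] θ = C (algebraMap F (RatFunc F) θ) :=
    fun θ => rfl
  simp_rw [← prod_units_one_sub F]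
  rw [Finset.prod_comm]
  refine Finset.prod_congr rfl fun θ _ => ?_
  have := congrArg (fun P => P.comp (C (algebraMap F (RatFunc F) θ) * X))
    (prod_one_sub_eq_one_sub_carlitzPoly F d)
  simp only [sub_comp, one_comp, carlitzPoly_comp_C_mul_X, prod_comp, mul_comp, C_comp,
    X_comp] at this
  rw [halg, ← this]
  exact Finset.prod_congr rfl fun a _ => by ring

end CarlitzPolynomials

/-! ### Power sums as logarithmic derivatives. -/

section LogarithmicDerivative

variable {K : Type*} [Field K]

/-- This is the geometric series y^n + y^(2n) + ... = y^n / (1 - y^n) at y = cX, the contribution of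
a single factor. -/
theorem mk_pow_mul_one_sub {n : ℕ} (hn : n ≠ 0) (c : K) :
    PowerSeries.mk (fun k => if k ≠ 0 ∧ n ∣ k then c ^ k else 0)
      * ((1 - (C c * X) ^ n : K[X]) : PowerSeries K) = ((C c * X) ^ n : K[X]) := by
  ext k
  have e : ((1 - (C c * X) ^ n : K[X]) : PowerSeries K)
      = 1 - PowerSeries.C (c ^ n) * PowerSeries.X ^ n := by
    simp [mul_pow]
  rw [e, mul_sub, mul_one, map_sub, mul_left_comm, PowerSeries.coeff_C_mul,
    PowerSeries.coeff_mul_X_pow', coeff_coe, mul_pow, ← C_pow, coeff_C_mul, coeff_X_pow]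
  simp only [PowerSeries.coeff_mk]
  rcases lt_trichotomy k n with h | rfl | h
  · have h1 : ¬ (k ≠ 0 ∧ n ∣ k) := fun ⟨h0, h1⟩ => absurd (Nat.le_of_dvd (by omega) h1) (by omega)
    simp [h1, h.ne, h.not_ge]
  · simp [hn]
  · obtain ⟨j, rfl⟩ : ∃ j, k = j + n := ⟨k - n, by omega⟩
    have hj : j ≠ 0 := by omega
    by_cases hd : n ∣ j <;> simp [hd, hj, hn, pow_add, mul_comm]

/-- Power sums as the logarithmic derivative of a product, in characteristic two. -/
theorem mk_powerSum_mul_prod [CharP K 2] {ι : Type*} (s : Finset ι) (f : ι → K) {n : ℕ} (hn : (n : K) = 1) :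
    PowerSeries.mk (fun k => if k ≠ 0 ∧ n ∣ k then ∑ i ∈ s, f i ^ k else 0)
        * ((∏ i ∈ s, (1 - (C (f i) * X) ^ n) : K[X]) : PowerSeries K)
      = (X * derivative (∏ i ∈ s, (1 - (C (f i) * X) ^ n)) : K[X]) := by
  classical
  have hn0 : n ≠ 0 := by rintro rfl; simp at hn
  induction s using Finset.induction_on with
  | empty => ext k; simp
  | insert a s ha ih =>
    have e : PowerSeries.mk (fun k => if k ≠ 0 ∧ n ∣ k then ∑ i ∈ insert a s, f i ^ k else 0)
        = PowerSeries.mk (fun k => if k ≠ 0 ∧ n ∣ k then f a ^ k else 0)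
          + PowerSeries.mk (fun k => if k ≠ 0 ∧ n ∣ k then ∑ i ∈ s, f i ^ k else 0) := by
      ext k
      rw [map_add]
      simp only [PowerSeries.coeff_mk, Finset.sum_insert ha]
      split_ifs <;> simp
    have hd : X * derivative (1 - (C (f a) * X) ^ n) = (C (f a) * X) ^ n := by
      obtain ⟨m, rfl⟩ : ∃ m, n = m + 1 := ⟨n - 1, by omega⟩
      rw [derivative_sub, derivative_one, derivative_pow, hn, C_1, derivative_mul, derivative_C,
        derivative_X, zero_sub, CharTwo.neg_eq, Nat.add_sub_cancel, pow_succ]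
      ring
    rw [Finset.prod_insert ha, derivative_mul, mul_add, ← mul_assoc, hd, mul_left_comm X]
    generalize ∏ i ∈ s, (1 - (C (f i) * X) ^ n) = P at ih ⊢
    have := mk_pow_mul_one_sub hn0 (f a)
    rw [e]
    push_cast at this ih ⊢
    linear_combination (P : PowerSeries K) * this
      + (1 - (PowerSeries.C (f a) * PowerSeries.X) ^ n) * ih

end LogarithmicDerivative

/-! ### Coefficients of the Carlitz polynomials and the generating functions in characteristic two.
-/

section CharTwo

variable (F : Type*) [Field F] [Fintype F]

/-- The linear coefficient of the Carlitz polynomial, `1 / ([1] ⋯ [d])`. -/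
noncomputable def carlitzCoeff (d : ℕ) : RatFunc F :=
  (∏ i ∈ Finset.range d, carlitzBracket F (i + 1))⁻¹

theorem carlitzCoeff_ne_zero (d : ℕ) : carlitzCoeff F d ≠ 0 :=
  inv_ne_zero (Finset.prod_ne_zero_iff.2 fun i _ => carlitzBracket_ne_zero F i.succ_ne_zero)

theorem carlitzCoeff_succ (d : ℕ) :
    carlitzCoeff F (d + 1) = carlitzCoeff F d / carlitzBracket F (d + 1) := by
  rw [carlitzCoeff, Finset.prod_range_succ, mul_inv, carlitzCoeff, div_eq_mul_inv]

/-- The ratio `[d+1] / [n] + 1`, the building block for the coefficients of the Carlitz polynomial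
of index `d`. -/
noncomputable def bracketRatio (n d : ℕ) : RatFunc F :=
  carlitzBracket F (d + 1) / carlitzBracket F n + 1

theorem card_cast_eq_zero : ((Fintype.card F : ℕ) : RatFunc F) = 0 := by
  rw [← map_natCast (algebraMap F (RatFunc F)), Nat.cast_card_eq_zero, map_zero]

variable [CharP F 2]

theorem one_add_bracketRatio (n d : ℕ) :
    1 + bracketRatio F n d = carlitzBracket F (d + 1) / carlitzBracket F n := by
  rw [bracketRatio, add_left_comm, CharTwo.add_self_eq_zero, add_zero]

theorem bracketRatio_one_succ (d : ℕ) :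
    bracketRatio F 1 (d + 1)
      = carlitzBracket F (d + 1) ^ Fintype.card F / carlitzBracket F 1 := by
  have h1 := carlitzBracket_ne_zero F one_ne_zero
  rw [bracketRatio, carlitzBracket_pow_card, CharTwo.sub_eq_add, add_div, div_self h1]

theorem bracketRatio_two_succ (d : ℕ) :
    bracketRatio F 2 (d + 1)
      = (bracketRatio F 1 d * carlitzBracket F 1) ^ Fintype.card F / carlitzBracket F 2 := by
  have h1 := carlitzBracket_ne_zero F one_ne_zero
  have h2 := carlitzBracket_ne_zero F two_ne_zero
  rw [bracketRatio, bracketRatio, add_mul, div_mul_cancel₀ _ h1, one_mul, add_pow_fintype_card,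
    carlitzBracket_pow_card, carlitzBracket_pow_card, div_add_one h2]
  congr 1
  linear_combination CharTwo.add_self_eq_zero (carlitzBracket F 1)

/-- The relation between the ratios that produces the factor `[1]^q / [2]`. -/
theorem bracketRatio_add_bracketRatio (d : ℕ) :
    bracketRatio F 1 d + bracketRatio F 2 d
      = carlitzBracket F 1 ^ Fintype.card F / carlitzBracket F 2 * (1 + bracketRatio F 1 d) := by
  have h1 := carlitzBracket_ne_zero F one_ne_zero
  have h2 := carlitzBracket_ne_zero F two_ne_zero
  rw [one_add_bracketRatio, carlitzBracket_pow_card, bracketRatio, bracketRatio, CharTwo.sub_eq_add]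
  field_simp
  linear_combination carlitzBracket F 1 * carlitzBracket F 2 *
    CharTwo.add_self_eq_zero (1 : RatFunc F)

/-- Only the terms of degree below q^3 matter later. Comparing coefficients in [d+1] E_{d+1} = E_d^q
+ E_d reduces the induction to the relations for `bracketRatio`. -/
theorem exists_carlitzPoly_eq (d : ℕ) : ∃ R : (RatFunc F)[X],
    carlitzPoly F d = C (carlitzCoeff F d) * X
      + C (bracketRatio F 1 d * carlitzCoeff F d ^ Fintype.card F) * X ^ Fintype.card F
      + C (bracketRatio F 1 d ^ Fintype.card F * bracketRatio F 2 d
          * carlitzCoeff F d ^ Fintype.card F ^ 2) * X ^ Fintype.card F ^ 2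
      + R * X ^ Fintype.card F ^ 3 := by
  have h1 := carlitzBracket_ne_zero F one_ne_zero
  have h2 := carlitzBracket_ne_zero F two_ne_zero
  induction d with
  | zero =>
    refine ⟨0, ?_⟩
    have e1 : bracketRatio F 1 0 = 0 := by
      rw [bracketRatio, zero_add, div_self h1, CharTwo.add_self_eq_zero]
    simp [carlitzPoly, carlitzCoeff, e1]
  | succ d ih =>
    obtain ⟨R, hR⟩ := ih
    have hD := carlitzBracket_ne_zero F d.succ_ne_zero
    -- The new remainder collects the q-th power of the x^(q^2) term, the q-th power of the old
    -- remainder, and the old remainder itself.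
    refine ⟨C (carlitzBracket F (d + 1))⁻¹ * (C (bracketRatio F 1 d ^ Fintype.card F
      * bracketRatio F 2 d * carlitzCoeff F d ^ Fintype.card F ^ 2) ^ Fintype.card F
      + R ^ Fintype.card F * X ^ (Fintype.card F ^ 3 * (Fintype.card F - 1)) + R), ?_⟩
    have ha : C (carlitzCoeff F (d + 1))
        = C (carlitzBracket F (d + 1))⁻¹ * C (carlitzCoeff F d) := by
      rw [carlitzCoeff_succ, ← C_mul, div_eq_inv_mul]
    have hb : C (bracketRatio F 1 (d + 1) * carlitzCoeff F (d + 1) ^ Fintype.card F)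
        = C (carlitzBracket F (d + 1))⁻¹ * (C (carlitzCoeff F d) ^ Fintype.card F
          + C (bracketRatio F 1 d * carlitzCoeff F d ^ Fintype.card F)) := by
      rw [← C_pow, ← C_add, ← C_mul]
      congr 1
      have e := one_add_bracketRatio F 1 d
      rw [eq_div_iff h1] at e
      rw [carlitzCoeff_succ, bracketRatio_one_succ, div_pow]
      field_simp
      linear_combination -carlitzCoeff F d ^ Fintype.card F * e
    have hc : C (bracketRatio F 1 (d + 1) ^ Fintype.card F * bracketRatio F 2 (d + 1)
          * carlitzCoeff F (d + 1) ^ Fintype.card F ^ 2)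
        = C (carlitzBracket F (d + 1))⁻¹ *
          (C (bracketRatio F 1 d * carlitzCoeff F d ^ Fintype.card F) ^ Fintype.card F
          + C (bracketRatio F 1 d ^ Fintype.card F * bracketRatio F 2 d
          * carlitzCoeff F d ^ Fintype.card F ^ 2)) := by
      rw [← C_pow, ← C_add, ← C_mul]
      congr 1
      have e := one_add_bracketRatio F 2 d
      rw [eq_div_iff h2] at e
      rw [carlitzCoeff_succ, bracketRatio_one_succ, bracketRatio_two_succ, div_pow, div_pow,
        ← pow_mul, ← sq, mul_pow, mul_pow, ← pow_mul, ← sq]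
      field_simp
      linear_combination
        -bracketRatio F 1 d ^ Fintype.card F * carlitzCoeff F d ^ Fintype.card F ^ 2 * e
    have hq := Fintype.card_pos (α := F)
    have e3 : (X : (RatFunc F)[X]) ^ (Fintype.card F ^ 3 * Fintype.card F)
        = X ^ (Fintype.card F ^ 3 * (Fintype.card F - 1)) * X ^ Fintype.card F ^ 3 := by
      rw [← pow_add, ← Nat.mul_add_one, Nat.sub_add_cancel hq]
    rw [ha, hb, hc, carlitzPoly, CharTwo.sub_eq_add, hR, add_pow_fintype_card,
      add_pow_fintype_card, add_pow_fintype_card, mul_pow, mul_pow, mul_pow, mul_pow, ← pow_mul X,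
      ← pow_mul X, ← pow_mul X, e3, ← pow_succ, ← sq]
    ring

theorem coeff_mul_carlitzPoly (d : ℕ) (φ : PowerSeries (RatFunc F)) {k : ℕ}
    (hk : k < Fintype.card F ^ 3) :
    PowerSeries.coeff k (φ * (carlitzPoly F d : PowerSeries (RatFunc F)))
      = carlitzCoeff F d * (if 1 ≤ k then PowerSeries.coeff (k - 1) φ else 0)
      + bracketRatio F 1 d * carlitzCoeff F d ^ Fintype.card F *
        (if Fintype.card F ≤ k then PowerSeries.coeff (k - Fintype.card F) φ else 0)
      + bracketRatio F 1 d ^ Fintype.card F * bracketRatio F 2 d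
          * carlitzCoeff F d ^ Fintype.card F ^ 2 *
        (if Fintype.card F ^ 2 ≤ k then PowerSeries.coeff (k - Fintype.card F ^ 2) φ else 0) := by
  obtain ⟨R, hR⟩ := exists_carlitzPoly_eq F d
  have e : φ * (carlitzPoly F d : PowerSeries (RatFunc F))
      = PowerSeries.C (carlitzCoeff F d) * (φ * PowerSeries.X ^ 1)
      + PowerSeries.C (bracketRatio F 1 d * carlitzCoeff F d ^ Fintype.card F)
        * (φ * PowerSeries.X ^ Fintype.card F)
      + PowerSeries.C (bracketRatio F 1 d ^ Fintype.card F * bracketRatio F 2 d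
          * carlitzCoeff F d ^ Fintype.card F ^ 2) * (φ * PowerSeries.X ^ Fintype.card F ^ 2)
      + φ * (R : PowerSeries (RatFunc F)) * PowerSeries.X ^ Fintype.card F ^ 3 := by
    rw [hR]
    simp only [coe_add, coe_mul, coe_C, coe_X, coe_pow]
    ring
  rw [e]
  simp only [map_add, PowerSeries.coeff_C_mul, PowerSeries.coeff_mul_X_pow']
  rw [if_neg hk.not_ge, add_zero]

theorem card_sub_one_cast : ((Fintype.card F - 1 : ℕ) : RatFunc F) = 1 := by
  rw [Nat.cast_sub Fintype.card_pos, card_cast_eq_zero, Nat.cast_one, zero_sub, CharTwo.neg_eq]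

theorem derivative_carlitzPoly (d : ℕ) :
    derivative (carlitzPoly F d) = C (carlitzCoeff F d) := by
  induction d with
  | zero => simp [carlitzPoly, carlitzCoeff]
  | succ d ih =>
    rw [carlitzPoly, CharTwo.sub_eq_add, derivative_C_mul, derivative_add, derivative_pow,
      card_cast_eq_zero, ih, carlitzCoeff_succ, div_eq_inv_mul, C_mul]
    simp

/-- The recursion reads [d+1] E_{d+1} = E_d (1 - E_d^(q-1)) up to a sign, which is invisible here.
The product is the one whose logarithmic derivative generates the sums S_{<d}. -/
theorem carlitzPoly_eq_prod (d : ℕ) :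
    carlitzPoly F d = C (carlitzCoeff F d) * X *
      ∏ i ∈ Finset.range d, (1 - carlitzPoly F i ^ (Fintype.card F - 1)) := by
  induction d with
  | zero => simp [carlitzPoly, carlitzCoeff]
  | succ d ih =>
    have hq : Fintype.card F - 1 + 1 = Fintype.card F := Nat.sub_add_cancel Fintype.card_pos
    have e : carlitzPoly F d ^ Fintype.card F - carlitzPoly F d
        = carlitzPoly F d * (1 - carlitzPoly F d ^ (Fintype.card F - 1)) := by
      conv_lhs => rw [← hq, pow_succ, ← neg_sub, CharTwo.neg_eq]
      ring
    rw [Finset.prod_range_succ, carlitzPoly, e, carlitzCoeff_succ, div_eq_inv_mul, C_mul]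
    linear_combination C (carlitzBracket F (d + 1))⁻¹
      * (1 - carlitzPoly F d ^ (Fintype.card F - 1)) * ih

/-- The generating function of the power sums of degree `d`. -/
theorem mk_powerSum_mul_one_sub_carlitzPoly (d : ℕ) :
    PowerSeries.mk (fun k => if k ≠ 0 then powerSum F d k else 0)
        * (1 - (carlitzPoly F d : PowerSeries (RatFunc F)))
      = PowerSeries.C (carlitzCoeff F d) * PowerSeries.X := by
  have h := mk_powerSum_mul_prod (monicsOfDegree F d)
    (fun a => (algebraMap F[X] (RatFunc F) a)⁻¹) (n := 1) Nat.cast_one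
  simp only [pow_one, prod_one_sub_eq_one_sub_carlitzPoly, isUnit_one, IsUnit.dvd, and_true,
    derivative_sub, derivative_one, derivative_carlitzPoly, zero_sub, CharTwo.neg_eq,
    inv_pow] at h
  simp only [powerSum, one_div]
  push_cast at h
  rw [h, mul_comm]

/-- The generating function of the power sums of degree less than `d` at multiples of `q - 1`. -/
theorem one_add_mk_powerSumLT_mul_carlitzPoly (d : ℕ) :
    (1 + PowerSeries.mk
        (fun k => if k ≠ 0 ∧ (Fintype.card F - 1) ∣ k then powerSumLT F d k else 0))
        * (carlitzPoly F d : PowerSeries (RatFunc F))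
      = PowerSeries.C (carlitzCoeff F d) * PowerSeries.X := by
  have h := mk_powerSum_mul_prod ((Finset.range d).sigma (monicsOfDegree F))
    (fun a => (algebraMap F[X] (RatFunc F) a.2)⁻¹) (card_sub_one_cast F)
  simp only [Finset.prod_sigma, prod_one_sub_pow_eq_one_sub_carlitzPoly_pow, Finset.sum_sigma,
    inv_pow] at h
  have hE := carlitzPoly_eq_prod F d
  have hE' := derivative_carlitzPoly F d
  set G := ∏ i ∈ Finset.range d, (1 - carlitzPoly F i ^ (Fintype.card F - 1)) with hG
  -- Differentiate E_d = c X G and use that E_d has constant derivative c. Dividing by G turns 1 + X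
  -- G'/G into 1/G = c X / E_d.
  have hG1 : G + X * derivative G = 1 := by
    apply mul_left_cancel₀ (C_ne_zero.2 (carlitzCoeff_ne_zero F d))
    rw [hE, mul_assoc, derivative_C_mul, derivative_mul, derivative_X, one_mul] at hE'
    rw [hE', mul_one]
  have hG2 := congrArg (fun P : (RatFunc F)[X] => (P : PowerSeries (RatFunc F))) hG1
  simp only [coe_add, coe_one] at hG2
  simp only [powerSumLT, powerSum, one_div]
  rw [← h] at hG2
  rw [hE]
  push_cast
  linear_combination (PowerSeries.C (carlitzCoeff F d) * PowerSeries.X) * hG2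

end CharTwo

/-! ### Closed forms for the power sums. -/

section PowerSums

variable (F : Type*) [Field F] [Fintype F] [CharP F 2]

theorem exists_card_eq_two_pow : ∃ m : ℕ, Fintype.card F = 2 ^ m := by
  obtain ⟨n, -, h⟩ := FiniteField.card F 2
  exact ⟨n, h⟩

theorem powerSum_eq_truncBinom (d : ℕ) {e f : ℕ} (he : e < Fintype.card F)
    (hf : f < Fintype.card F) :
    powerSum F d (e * Fintype.card F + f + 1)
      = carlitzCoeff F d ^ (e * Fintype.card F + f + 1)
        * truncBinom 1 (bracketRatio F 1 d) e (Fintype.card F - 1 - f) := by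
  obtain ⟨m, hm⟩ := exists_card_eq_two_pow F
  have hq : 1 < Fintype.card F := Fintype.one_lt_card
  have hgen := mk_powerSum_mul_one_sub_carlitzPoly F d
  have hrec : ∀ k, k < Fintype.card F ^ 3 → _ := fun k hk =>
    (congrArg (PowerSeries.coeff k) hgen).symm.trans <| by
      rw [mul_sub, mul_one, map_sub, coeff_mul_carlitzPoly F d _ hk]
  simp only [PowerSeries.coeff_mk, PowerSeries.coeff_C_mul, PowerSeries.coeff_X] at hrec
  have hlt : Fintype.card F ^ 2 < Fintype.card F ^ 3 := Nat.pow_lt_pow_right hq (by norm_num)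
  have hlt' : Fintype.card F < Fintype.card F ^ 2 := by nlinarith
  refine eq_truncBinom_of_recurrence' hm (carlitzCoeff F d) (bracketRatio F 1 d)
    (fun k => powerSum F d (k + 1)) ?_ ?_ ?_ e he f hf
  · have := hrec 1 (by omega)
    simp [hq.not_ge, (hq.trans hlt').not_ge] at this
    simpa using this.symm
  · intro k hk
    have := hrec (k + 2) (by omega)
    -- Since k + 2 ≤ q, the x^q term could only meet the constant coefficient of the series, which
    -- is zero.
    have h1 : (if Fintype.card F ≤ k + 2 then
        (if k + 2 - Fintype.card F ≠ 0 then powerSum F d (k + 2 - Fintype.card F) else 0) else 0)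
          = 0 := by
      rw [if_neg (c := k + 2 - Fintype.card F ≠ 0) (by omega)]
      simp
    have h2 : ¬ (Fintype.card F ^ 2 ≤ k + 2) := by omega
    rw [h1, if_neg h2] at this
    simp at this
    linear_combination -this
  · intro k hk
    have := hrec (k + Fintype.card F + 1) (by omega)
    have h1 : (if Fintype.card F ^ 2 ≤ k + Fintype.card F + 1 then
        (if k + Fintype.card F + 1 - Fintype.card F ^ 2 ≠ 0 then
          powerSum F d (k + Fintype.card F + 1 - Fintype.card F ^ 2) else 0) else 0)
          = 0 := by
      rw [if_neg (c := k + Fintype.card F + 1 - Fintype.card F ^ 2 ≠ 0) (by omega)]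
      simp
    have h2 : k + Fintype.card F + 1 - Fintype.card F = k + 1 := by omega
    have h3 : k + Fintype.card F - 1 + 1 = k + Fintype.card F := by omega
    have h5 : Fintype.card F ≤ k + Fintype.card F + 1 := by omega
    rw [h1, h2, if_pos h5] at this
    simp at this
    rw [h3]
    linear_combination -this

theorem powerSumLT_eq_truncBinom (d : ℕ) {s n : ℕ} (hs : s ≤ Fintype.card F)
    (hn : n ≤ Fintype.card F) (h0 : s * Fintype.card F + n ≠ 0) :
    powerSumLT F d ((Fintype.card F - 1) * (s * Fintype.card F + n))
      = (bracketRatio F 1 d * carlitzCoeff F d ^ (Fintype.card F - 1)) ^ (s * Fintype.card F)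
        * truncBinom (bracketRatio F 1 d * carlitzCoeff F d ^ (Fintype.card F - 1))
          (bracketRatio F 2 d * carlitzCoeff F d ^ (Fintype.card F - 1)) s n := by
  obtain ⟨m, hm⟩ := exists_card_eq_two_pow F
  have hc := carlitzCoeff_ne_zero F d
  have hgen := one_add_mk_powerSumLT_mul_carlitzPoly F d
  have hrec : ∀ k, k < Fintype.card F ^ 3 → _ := fun k hk =>
    (congrArg (PowerSeries.coeff k) hgen).symm.trans (coeff_mul_carlitzPoly F d _ hk)
  simp only [PowerSeries.coeff_C_mul, PowerSeries.coeff_X] at hrec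
  -- Pass to the variable w = x^(q-1), in which E_d/(c x) becomes 1 + z w + z^q g w^(q+1) up to
  -- higher terms.
  have hw : ∀ j, PowerSeries.coeff ((Fintype.card F - 1) * j) (1 + PowerSeries.mk
      (fun k => if k ≠ 0 ∧ (Fintype.card F - 1) ∣ k then powerSumLT F d k else 0))
      = if j = 0 then 1 else powerSumLT F d ((Fintype.card F - 1) * j) := by
    intro j
    have hq : Fintype.card F - 1 ≠ 0 := Nat.sub_ne_zero_of_lt Fintype.one_lt_card
    rcases eq_or_ne j 0 with rfl | hj
    · simp
    · simp [PowerSeries.coeff_one, hj, hq]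
  have hq : 1 < Fintype.card F := Fintype.one_lt_card
  obtain ⟨r, hr⟩ : ∃ r, Fintype.card F = r + 1 := ⟨Fintype.card F - 1, by omega⟩
  have := eq_truncBinom_of_recurrence hm
    (bracketRatio F 1 d * carlitzCoeff F d ^ (Fintype.card F - 1))
    (bracketRatio F 2 d * carlitzCoeff F d ^ (Fintype.card F - 1))
    (fun j => if j = 0 then 1 else powerSumLT F d ((Fintype.card F - 1) * j))
    (by simp) ?_ ?_ s hs n hn
  · simpa only [if_neg h0] using this
  · intro k hk
    have hb : (Fintype.card F - 1) * (k + 1) + 1 < Fintype.card F ^ 2 := by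
      rw [hr] at hk hq ⊢
      rw [Nat.add_sub_cancel]
      nlinarith
    have := hrec ((Fintype.card F - 1) * (k + 1) + 1)
      (hb.trans (Nat.pow_lt_pow_right hq (by norm_num)))
    have hpos : 0 < (Fintype.card F - 1) * (k + 1) := Nat.mul_pos (by omega) k.succ_pos
    have hle : Fintype.card F ≤ (Fintype.card F - 1) * (k + 1) + 1 := by
      rw [hr, Nat.add_sub_cancel]; nlinarith
    have hsub : (Fintype.card F - 1) * (k + 1) + 1 - Fintype.card F = (Fintype.card F - 1) * k := by
      rw [hr, Nat.add_sub_cancel, mul_add, mul_one]; omega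
    rw [if_neg hb.not_ge, if_pos hle, if_pos (Nat.le_add_left _ _), Nat.add_sub_cancel, hsub,
      if_neg (by omega), hw, hw] at this
    apply mul_left_cancel₀ hc
    have e : carlitzCoeff F d ^ Fintype.card F
        = carlitzCoeff F d * carlitzCoeff F d ^ (Fintype.card F - 1) := by
      rw [← pow_succ', Nat.sub_add_cancel hq.le]
    rw [e] at this
    rw [← sub_eq_zero, CharTwo.sub_eq_add]
    linear_combination -this
  · intro k hk
    -- The shifts by 1, q and q^2 in x become shifts by 0, 1 and q + 1 in the index of w.
    have e1 : (Fintype.card F - 1) * (k + Fintype.card F + 1) + 1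
        = (Fintype.card F - 1) * k + Fintype.card F ^ 2 := by
      rw [hr, Nat.add_sub_cancel]; ring
    have e2 : (Fintype.card F - 1) * k + Fintype.card F ^ 2 - Fintype.card F
        = (Fintype.card F - 1) * (k + Fintype.card F) := by
      rw [Nat.sub_eq_iff_eq_add (by nlinarith), hr, Nat.add_sub_cancel]; ring
    have e3 : (Fintype.card F - 1) * k + Fintype.card F ^ 2 - 1
        = (Fintype.card F - 1) * (k + Fintype.card F + 1) := by omega
    have hb : (Fintype.card F - 1) * k + Fintype.card F ^ 2 < Fintype.card F ^ 3 := by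
      have : k < Fintype.card F ^ 2 := by omega
      rw [hr] at this hq ⊢
      rw [Nat.add_sub_cancel]
      nlinarith
    have := hrec _ hb
    have hq2 : Fintype.card F < Fintype.card F ^ 2 := by nlinarith
    rw [e2, e3, Nat.add_sub_cancel, if_neg (by omega), if_pos (by omega), if_pos (by omega),
      if_pos (by omega), hw, hw, hw] at this
    apply mul_left_cancel₀ hc
    have e : carlitzCoeff F d ^ Fintype.card F
        = carlitzCoeff F d * carlitzCoeff F d ^ (Fintype.card F - 1) := by
      rw [← pow_succ', Nat.sub_add_cancel hq.le]
    have e' : carlitzCoeff F d ^ Fintype.card F ^ 2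
        = carlitzCoeff F d * (carlitzCoeff F d ^ (Fintype.card F - 1)) ^ Fintype.card F
          * carlitzCoeff F d ^ (Fintype.card F - 1) := by
      rw [← pow_mul, ← pow_succ', ← pow_add]
      congr 1
      rw [hr, Nat.add_sub_cancel]; ring
    rw [e, e'] at this
    rw [← sub_eq_zero, CharTwo.sub_eq_add, mul_pow]
    linear_combination -this

theorem powerSum_mul_card (d k : ℕ) :
    powerSum F d (k * Fintype.card F) = powerSum F d k ^ Fintype.card F := by
  obtain ⟨m, hm⟩ := exists_card_eq_two_pow F
  rw [powerSum, powerSum, hm, sum_pow_char_pow]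
  exact Finset.sum_congr rfl fun a _ => by rw [div_pow, one_pow, pow_mul]

/-- `S_d(k)` for `k = e q + q - i` with `i ≤ e < q` and `i < q`. -/
theorem powerSum_eq (d : ℕ) {e i k : ℕ} (he : e < Fintype.card F) (hie : i ≤ e)
    (hk : k + i = (e + 1) * Fintype.card F) :
    powerSum F d k = carlitzCoeff F d ^ k * (1 + bracketRatio F 1 d) ^ i := by
  have := powerSum_eq_truncBinom F d he (f := Fintype.card F - 1 - i) (by omega)
  rw [truncBinom_eq_add_pow _ _ (by omega)] at this
  rw [show k = e * Fintype.card F + (Fintype.card F - 1 - i) + 1 by rw [add_mul] at hk; omega, this]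
  congr 2
  omega

/-- The expansion of exponent q - 1 is cut after its linear term, whose coefficient q - 1 equals 1
in F. -/
theorem powerSum_card_add_one (d : ℕ) :
    powerSum F d (Fintype.card F + 1)
      = carlitzCoeff F d ^ (Fintype.card F + 1) * (1 + bracketRatio F 1 d) := by
  have hq : 1 < Fintype.card F := Fintype.one_lt_card
  have := powerSum_eq_truncBinom F d hq (f := 0) (by omega)
  obtain ⟨n, hn⟩ : ∃ n, Fintype.card F - 1 - 0 = n + 1 := ⟨Fintype.card F - 2, by omega⟩
  have hn' : ((n + 1 : ℕ) : RatFunc F) = 1 := by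
    rw [← hn, Nat.sub_zero, card_sub_one_cast]
  rw [hn, truncBinom_one_left, hn', one_pow, one_mul, one_mul, one_mul, add_zero] at this
  exact this

theorem powerSum_card_sq_add_card (d : ℕ) :
    powerSum F d (Fintype.card F ^ 2 + Fintype.card F)
      = carlitzCoeff F d ^ (Fintype.card F ^ 2 + Fintype.card F)
        * (1 + bracketRatio F 1 d) ^ Fintype.card F := by
  rw [show Fintype.card F ^ 2 + Fintype.card F = (Fintype.card F + 1) * Fintype.card F by ring,
    powerSum_mul_card, pow_mul, ← mul_pow]
  congr 1
  exact powerSum_card_add_one F d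

/-- `S_{<d}((q-1)(sq+n))` for `n ≤ s ≤ q`. -/
theorem powerSumLT_eq (d : ℕ) {s n k : ℕ} (hs : s ≤ Fintype.card F) (hn : n ≤ s) (hs0 : s ≠ 0)
    (hk : k = (Fintype.card F - 1) * (s * Fintype.card F + n)) :
    powerSumLT F d k
      = carlitzCoeff F d ^ k * (bracketRatio F 1 d ^ (s * Fintype.card F)
        * (carlitzBracket F 1 ^ Fintype.card F / carlitzBracket F 2
          * (1 + bracketRatio F 1 d)) ^ n) := by
  have hq : 1 < Fintype.card F := Fintype.one_lt_card
  have h0 : 0 < s * Fintype.card F := Nat.mul_pos (Nat.pos_of_ne_zero hs0) (by omega)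
  rw [hk, powerSumLT_eq_truncBinom F d hs (hn.trans hs) (by omega), truncBinom_eq_add_pow _ _ hn,
    ← bracketRatio_add_bracketRatio, ← add_mul, mul_pow, mul_pow, ← pow_mul, ← pow_mul, mul_add,
    pow_add]
  ring

end PowerSums

/-! ### Special power sums, and the comparison of multizeta values. -/

section Multizeta

variable (F : Type*) [Field F] [Fintype F] [CharP F 2]

theorem powerSum_two (d : ℕ) : powerSum F d 2 = carlitzCoeff F d ^ 2 * 1 := by
  have := powerSum_eq_truncBinom F d Fintype.card_pos (f := 1) Fintype.one_lt_card
  simpa [truncBinom_zero_left] using this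

/-- Here 2q - 2 = q + (q - 2), and the linear term of the truncated expansion dies because q - 2 is
zero in F. For 2q - 1 = q + (q - 1), treated next, it survives with coefficient 1. -/
theorem powerSumLT_two_mul_card_sub_two (d : ℕ) {k : ℕ}
    (hk : k = (Fintype.card F - 1) * (2 * Fintype.card F - 2)) :
    powerSumLT F d k
      = carlitzCoeff F d ^ k * bracketRatio F 1 d ^ (2 * Fintype.card F - 2) := by
  have hq : 1 < Fintype.card F := Fintype.one_lt_card
  obtain ⟨n, hn⟩ : ∃ n, Fintype.card F = n + 2 := ⟨Fintype.card F - 2, by omega⟩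
  have hz : ((n : ℕ) : RatFunc F) = 0 := by
    have h0 := card_cast_eq_zero F
    rw [hn, Nat.cast_add, Nat.cast_two, CharTwo.two_eq_zero, add_zero] at h0
    exact h0
  have ht : ∀ z g : RatFunc F, truncBinom z g 1 n = z ^ n := by
    intro z g
    rcases n with _ | n
    · rw [truncBinom_zero_right, pow_zero]
    · rw [truncBinom_one_left, hz, zero_mul, add_zero, pow_succ]
  have := powerSumLT_eq_truncBinom F d hq.le (n := n) (by omega) (by omega)
  rw [ht, ← pow_add, mul_pow, ← pow_mul] at this
  rw [show k = (Fintype.card F - 1) * (1 * Fintype.card F + n) by rw [hk]; congr 1; omega, this,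
    show 2 * Fintype.card F - 2 = 1 * Fintype.card F + n by omega, mul_comm]

theorem powerSumLT_two_mul_card_sub_one (d : ℕ) {k : ℕ}
    (hk : k = (Fintype.card F - 1) * (2 * Fintype.card F - 1)) :
    powerSumLT F d k
      = carlitzCoeff F d ^ k * (bracketRatio F 1 d ^ (2 * Fintype.card F - 2)
        * (carlitzBracket F 1 ^ Fintype.card F / carlitzBracket F 2
          * (1 + bracketRatio F 1 d))) := by
  have hq : 1 < Fintype.card F := Fintype.one_lt_card
  obtain ⟨n, hn⟩ : ∃ n, Fintype.card F = n + 2 := ⟨Fintype.card F - 2, by omega⟩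
  have hz := card_sub_one_cast F
  rw [show Fintype.card F - 1 = n + 1 by omega] at hz
  have := powerSumLT_eq_truncBinom F d hq.le (n := n + 1) (by omega) (by omega)
  rw [truncBinom_one_left, hz, one_mul (bracketRatio F 2 d * _), ← add_mul] at this
  rw [show k = (Fintype.card F - 1) * (1 * Fintype.card F + (n + 1)) by rw [hk]; congr 1; omega,
    this, ← bracketRatio_add_bracketRatio,
    show 2 * Fintype.card F - 2 = 1 * Fintype.card F + n by omega]
  ring

end Multizeta

/-- A termwise criterion for the proportionality of multizeta values of equal weight. -/
theorem multizeta_eq_mul_of_termwise (F : Type*) [Field F] [Fintype F] [DecidableEq (RatFunc F)] {a b a' b' : ℕ}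
    (h : a + b = a' + b') {r : RatFunc F} {A B A' B' : ℕ → RatFunc F}
    (hA : ∀ d, powerSum F d a = carlitzCoeff F d ^ a * A d)
    (hB : ∀ d, powerSumLT F d b = carlitzCoeff F d ^ b * B d)
    (hA' : ∀ d, powerSum F d a' = carlitzCoeff F d ^ a' * A' d)
    (hB' : ∀ d, powerSumLT F d b' = carlitzCoeff F d ^ b' * B' d)
    (hr : ∀ d, A d * B d = r * (A' d * B' d)) :
    multizeta F a b
      = algebraMap (RatFunc F) (RatFunc.CompletionAtInfty F) r * multizeta F a' b' := by
  rw [multizeta, multizeta, ← tsum_mul_left]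
  refine tsum_congr fun d => ?_
  rw [← map_mul, iteratedPowerSum, iteratedPowerSum, hA, hB, hA', hB']
  congr 1
  have hp := congrArg (carlitzCoeff F d ^ ·) h
  simp only [pow_add] at hp
  linear_combination carlitzCoeff F d ^ a * carlitzCoeff F d ^ b * hr d
    + r * A' d * B' d * hp

/-- The exponents 0 and 1 enter only through their sum, since q^k = 1 + k(q - 1) for both. -/
theorem sum_pow_of_le_one {N : ℕ} (q : ℤ) {k : Fin N → ℕ} (hk : ∀ i, k i ≤ 1) :
    ∑ i, q ^ k i = N + (∑ i, k i : ℕ) * (q - 1) := by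
  have : ∀ i, q ^ k i = 1 + (k i : ℤ) * (q - 1) := by
    intro i
    have := hk i
    interval_cases k i <;> simp
  simp_rw [this, Finset.sum_add_distrib, ← Finset.sum_mul]
  simp

theorem sum_le_of_le_one {N : ℕ} {k : Fin N → ℕ} (hk : ∀ i, k i ≤ 1) : ∑ i, k i ≤ N := by
  simpa using Finset.sum_le_sum fun i (_ : i ∈ Finset.univ) => hk i

theorem sum_eq_sum_add_one_of_existsUnique_lt {N : ℕ} {k l : Fin N → ℕ} (hk : ∀ i, k i ≤ 1)
    (hlk : ∀ i, l i ≤ k i) (h : ∃! i, l i < k i) : ∑ i, k i = ∑ i, l i + 1 := by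
  obtain ⟨i₀, h0, hu⟩ := h
  have : ∀ i, k i = l i + if i = i₀ then 1 else 0 := by
    intro i
    have h1 := hk i
    have h2 := hlk i
    split_ifs with h
    · subst h; omega
    · have h3 : ¬ l i < k i := fun h' => h (hu i h')
      omega
  simp_rw [this, Finset.sum_add_distrib]
  simp

theorem theorem3 (F : Type*) [Field F] [Fintype F] [DecidableEq (RatFunc F)]
    (q : ℕ) (hqF : Fintype.card F = q) (hq : ∃ m : ℕ, q = 2 ^ m) :
    -- first family
    (∀ s : ℕ, 1 ≤ s → s ≤ q →
      ∀ k : Fin (s - 1) → ℕ, (∀ i, k i ≤ 1) → Monotone k →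
      ∀ b b' : ℕ,
        (b : ℤ) = s * q ^ 2 - ∑ i, (q : ℤ) ^ k i - 1 →
        (b' : ℤ) = s * q ^ 2 - ∑ i, (q : ℤ) ^ k i - q →
        multizeta F 2 b =
          algebraMap (RatFunc F) (RatFunc.CompletionAtInfty F)
            (carlitzBracket F 1 ^ q / carlitzBracket F 2) *
          multizeta F (q + 1) b') ∧
    -- second identity
    (∀ b b' : ℕ,
        (b : ℤ) = 2 * q ^ 2 - 3 * q + 1 →
        (b' : ℤ) = 2 * q ^ 2 - 4 * q + 2 →
        multizeta F 2 b =
          algebraMap (RatFunc F) (RatFunc.CompletionAtInfty F)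
            (carlitzBracket F 1 ^ q / carlitzBracket F 2) *
          multizeta F (q + 1) b') ∧
    -- third family
    (∀ s : ℕ, s < q →
      ∀ k l : Fin s → ℕ, (∀ i, k i ≤ 1) → (∀ i, l i ≤ 1) → Monotone l → Monotone k →
      (∀ i, l i ≤ k i) → (∃! i, l i < k i) →
      ∀ a b a' b' : ℕ,
        (a : ℤ) = q ^ 2 - ∑ i, (q : ℤ) ^ k i →
        (b : ℤ) = 2 * q ^ 2 - 3 * q + 1 →
        (a' : ℤ) = q ^ 2 - ∑ i, (q : ℤ) ^ l i →
        (b' : ℤ) = 2 * q ^ 2 - 4 * q + 2 →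
        multizeta F a b =
          algebraMap (RatFunc F) (RatFunc.CompletionAtInfty F)
            (carlitzBracket F 1 ^ q / carlitzBracket F 2) *
          multizeta F a' b') ∧
    -- fourth family
    (∀ i j : ℕ, i ≤ 2 → j ≤ 2 - i →
      ∀ a b b' : ℕ,
        (a : ℤ) = 4 * q - 2 →
        (b : ℤ) = q ^ 3 - i * q ^ 2 - j * q - (q - i - j) →
        (b' : ℤ) = q ^ 3 - i * q ^ 2 - (q - (2 - j)) * q - (2 - i - j) →
        multizeta F a b =
          algebraMap (RatFunc F) (RatFunc.CompletionAtInfty F)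
            (carlitzBracket F 1 ^ ((q - 2) * q) / carlitzBracket F 2 ^ (q - 2)) *
          multizeta F (q ^ 2 + q) b') ∧
    -- fifth family
    (2 < q → ∀ i : ℕ, i ≤ 2 →
      ∀ a b b' : ℕ,
        (a : ℤ) = 3 * q - 1 →
        (b : ℤ) = q ^ 3 - (q - 1) - q ^ i →
        (b' : ℤ) = q ^ 3 - (q - 1) * q - q ^ i →
        multizeta F a b =
          algebraMap (RatFunc F) (RatFunc.CompletionAtInfty F)
            (carlitzBracket F 1 ^ ((q - 1) * q) / carlitzBracket F 2 ^ (q - 1)) *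
          multizeta F (q ^ 2 + q) b') := by
  subst hqF
  obtain ⟨m, hm⟩ := hq
  have hchar : CharP F 2 := charP_of_card_eq_prime_pow hm
  have hq : 1 < Fintype.card F := Fintype.one_lt_card
  have hq1 : ((Fintype.card F - 1 : ℕ) : ℤ) = (Fintype.card F : ℤ) - 1 := by
    rw [Nat.cast_sub hq.le, Nat.cast_one]
  have hfour : Fintype.card F ≠ 2 → 4 ≤ Fintype.card F := by
    intro h2
    rcases m with _ | _ | m
    · omega
    · omega
    · have := Nat.one_le_two_pow (n := m)
      rw [pow_succ, pow_succ] at hm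
      omega
  set q := Fintype.card F with hqdef
  have hpow : ∀ n, carlitzBracket F 1 ^ (n * q) / carlitzBracket F 2 ^ n
      = (carlitzBracket F 1 ^ q / carlitzBracket F 2) ^ n := fun n => by
    rw [mul_comm, pow_mul, ← div_pow]
  refine ⟨?_, ?_, ?_, ?_, ?_⟩
  · intro s hs hsq k hk _ b b' hb hb'
    have hr := sum_le_of_le_one hk
    rw [sum_pow_of_le_one _ hk] at hb hb'
    generalize ∑ i, k i = r at *
    -- With r the number of exponents equal to 1, b/(q-1) and b'/(q-1) are s q + (s - r) and s q +
    -- (s - r - 1): one factor is traded.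
    obtain ⟨n, rfl⟩ : ∃ n, s = r + n + 1 := ⟨s - 1 - r, by omega⟩
    have hbn : b = (q - 1) * ((r + n + 1) * q + (n + 1)) := by
      zify; rw [hb, hq1]; push_cast; ring
    have hbn' : b' = (q - 1) * ((r + n + 1) * q + n) := by
      zify; rw [hb', hq1]; push_cast; ring
    refine multizeta_eq_mul_of_termwise F (by zify; rw [hb, hb']; ring)
      (powerSum_two F) (fun d => powerSumLT_eq F d hsq (by omega) (by omega) hbn)
      (powerSum_card_add_one F) (fun d => powerSumLT_eq F d hsq (by omega) (by omega) hbn') ?_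
    intro d
    ring
  · intro b b' hb hb'
    have hbn : b = (q - 1) * (2 * q - 1) := by
      zify [show 1 ≤ 2 * q by omega]; rw [hb, hq1]; ring
    have hbn' : b' = (q - 1) * (2 * q - 2) := by
      zify [show 2 ≤ 2 * q by omega]; rw [hb', hq1]; ring
    refine multizeta_eq_mul_of_termwise F (by zify; rw [hb, hb']; ring)
      (powerSum_two F) (fun d => powerSumLT_two_mul_card_sub_one F d hbn)
      (powerSum_card_add_one F) (fun d => powerSumLT_two_mul_card_sub_two F d hbn') ?_
    intro d
    ring
  · intro s hs k l hk hl _ _ hlk hex a b a' b' ha hb ha' hb'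
    have hbn : b = (q - 1) * (2 * q - 1) := by
      zify [show 1 ≤ 2 * q by omega]; rw [hb, hq1]; ring
    have hbn' : b' = (q - 1) * (2 * q - 2) := by
      zify [show 2 ≤ 2 * q by omega]; rw [hb', hq1]; ring
    have hr := sum_le_of_le_one hk
    have hsum := sum_eq_sum_add_one_of_existsUnique_lt hk hlk hex
    rw [sum_pow_of_le_one _ hk, hsum] at ha
    rw [sum_pow_of_le_one _ hl] at ha'
    rw [hsum] at hr
    generalize ∑ i, l i = r at *
    obtain ⟨n, rfl⟩ : ∃ n, s = r + 1 + n := ⟨s - (r + 1), by omega⟩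
    have hsum : a + b = a' + b' := by zify; rw [ha, hb, ha', hb']; push_cast; ring
    refine multizeta_eq_mul_of_termwise F hsum
      -- Here a = (q-r-1)q - n and a' = (q-r)q - (n+1); the condition n ≤ q - r - 2 is exactly s <
      -- q.
      (fun d => powerSum_eq F d (e := q - r - 2) (i := n) (by omega) (by omega) ?_)
      (fun d => powerSumLT_two_mul_card_sub_one F d hbn)
      (fun d => powerSum_eq F d (e := q - r - 1) (i := n + 1) (by omega) (by omega) ?_)
      (fun d => powerSumLT_two_mul_card_sub_two F d hbn') ?_
    · rw [show q - r - 2 + 1 = q - (r + 1) by omega]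
      zify [show r + 1 ≤ q by omega]; rw [ha]; push_cast; ring
    · rw [show q - r - 1 + 1 = q - r by omega]
      zify [show r ≤ q by omega]; rw [ha']; push_cast; ring
    · intro d
      ring
  · intro i j hi hj a b b' ha hb hb'
    -- The closed form for S_d(4q-2) needs 3 < q. For q = 2 both sides coincide and the factor is 1.
    rcases eq_or_ne q 2 with h2 | h2
    · have hab : a = q ^ 2 + q := by zify; rw [ha, h2]; norm_num
      have hbb : b = b' := by zify; rw [hb, hb', h2]; push_cast; ring
      rw [hab, hbb, h2]
      simp
    have h4 := hfour h2
    have hbn : b = (q - 1) * ((q - i) * q + (q - i - j)) := by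
      zify [show i ≤ q by omega, show j ≤ q - i by omega]; rw [hb, hq1]; ring
    have hbn' : b' = (q - 1) * ((q - i) * q + (2 - i - j)) := by
      zify [show i ≤ q by omega, hi, hj]; rw [hb', hq1]; ring
    refine multizeta_eq_mul_of_termwise F (by zify; rw [ha, hb, hb']; ring)
      (fun d => powerSum_eq F d (e := 3) (i := 2) (by omega) (by omega) ?_)
      (fun d => powerSumLT_eq F d (Nat.sub_le q i) (by omega) (by omega) hbn)
      (powerSum_card_sq_add_card F)
      (fun d => powerSumLT_eq F d (Nat.sub_le q i) (by omega) (by omega) hbn') ?_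
    · zify; rw [ha]; ring
    · intro d
      rw [hpow, ← hqdef]
      generalize carlitzBracket F 1 ^ q / carlitzBracket F 2 = ρ
      -- Here q - 2 factors are traded: together with the (1+u)^2 from S_d(4q-2) they make up the
      -- (1+u)^q from S_d(q^2+q).
      rw [show q - i - j = (q - 2) + (2 - i - j) by omega]
      rw [show (1 + bracketRatio F 1 d) ^ q = (1 + bracketRatio F 1 d) ^ (q - 2)
        * (1 + bracketRatio F 1 d) ^ 2 by rw [← pow_add]; congr 1; omega, pow_add,
        mul_pow ρ _ (q - 2)]
      ring
  · intro h2 i hi a b b' ha hb hb'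
    -- S_d(3q-1) supplies one factor 1+u and q - 1 are traded. The three values of i differ only in
    -- (s, n, n'), namely (q, q, 1), (q, q-1, 0) and (q-1, q-1, 0).
    have key : ∀ s n n' : ℕ, s ≤ q → n ≤ s → n' ≤ s → s ≠ 0 → n = (q - 1) + n' →
        b = (q - 1) * (s * q + n) → b' = (q - 1) * (s * q + n') →
        multizeta F a b =
          algebraMap (RatFunc F) (RatFunc.CompletionAtInfty F)
            (carlitzBracket F 1 ^ ((q - 1) * q) / carlitzBracket F 2 ^ (q - 1)) *
          multizeta F (q ^ 2 + q) b' := by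
      intro s n n' hs hn hn' hs0 hnn hbn hbn'
      refine multizeta_eq_mul_of_termwise F (by zify; rw [ha, hb, hb']; ring)
        (fun d => powerSum_eq F d (e := 2) (i := 1) (by omega) (by omega) ?_)
        (fun d => powerSumLT_eq F d hs hn hs0 hbn)
        (powerSum_card_sq_add_card F)
        (fun d => powerSumLT_eq F d hs hn' hs0 hbn') ?_
      · zify; rw [ha]; ring
      · intro d
        rw [hpow, ← hqdef]
        generalize carlitzBracket F 1 ^ q / carlitzBracket F 2 = ρ
        rw [show (1 + bracketRatio F 1 d) ^ q = (1 + bracketRatio F 1 d) ^ (q - 1)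
          * (1 + bracketRatio F 1 d) by rw [← pow_succ]; congr 1; omega, hnn, pow_add,
          mul_pow ρ _ (q - 1)]
        ring
    interval_cases i
    · refine key q q 1 le_rfl le_rfl (by omega) (by omega) (by omega) ?_ ?_ <;> zify
      · rw [hb, hq1]; ring
      · rw [hb', hq1]; ring
    · refine key q (q - 1) 0 le_rfl (by omega) (by omega) (by omega) (by omega) ?_ ?_ <;> zify
      · rw [hb, hq1]; ring
      · rw [hb', hq1]; ring
    · refine key (q - 1) (q - 1) 0 (by omega) le_rfl (by omega) (by omega) (by omega) ?_ ?_ <;> zify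
      · rw [hb, hq1]; ring
      · rw [hb', hq1]; ring
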